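/- Let $X$ be a complete metric space that is not locally compact. Let $d(X)$ be the density of $X$, that is, the least cardinality of a dense subset of $X$. For a point $x\in X$ let $\mathrm{ld}(x)$ be the least density of a neighborhood of $x$, and let $\mathrm{ld}(X)=\sup_{x\in X}\mathrm{ld}(x)$. Let $K(X)$ be the family of compact subsets of $X$, ordered by inclusion; for a cardinal $\kappa$ let $[\kappa]^{\aleph_0}$ be the family of countably infinite subsets of $\kappa$, ordered by inclusion; let $\mathrm{cof}(P)$ be the least cardinality of a cofinal subset of a partially ordered set $P$; and let $\mathfrak d=\mathrm{cof}(\mathbb N^{\mathbb N},\le)$, where $\le$ is the pointwise order. Assume that $\mathrm{ld}(x)=\mathrm{ld}(X)$ for some point $x\in X$, or that the cardinal $\mathrm{ld}(X)$ has uncountable cofinality. Then: 1. $\mathrm{cof}(K(X))=d(X)\cdot\mathfrak d\cdot\mathrm{cof}([\mathrm{ld}(X)]^{\aleph_0})$. 2. If $d(X)=\mathrm{ld}(X)$, then $\mathrm{cof}(K(X))=\mathfrak d\cdot\mathrm{cof}([d(X)]^{\aleph_0})$. -/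

import Mathlib

open Cardinal TopologicalSpace Topology

/-- The density of a topological space: the least cardinality of a dense subset. -/
noncomputable def topDensity (X : Type*) [TopologicalSpace X] : Cardinal :=
  sInf {c | ∃ D : Set X, Dense D ∧ #D = c}

/-- The local density of a point: the least density of a neighborhood of the point
(a neighborhood carries the subspace topology). -/
noncomputable def pointLocalDensity {X : Type*} [TopologicalSpace X] (x : X) : Cardinal :=
  sInf {c | ∃ U ∈ 𝓝 x, topDensity U = c}

/-- The local density of a space: the supremum of the local densities of its points.
The family is indexed by `X` itself, so it is bounded and this is its least upper bound. -/
noncomputable def localDensity (X : Type*) [TopologicalSpace X] : Cardinal :=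
  ⨆ x : X, pointLocalDensity x

/-- The local density of the space is attained at some point. -/
def LocalDensityRealized (X : Type*) [TopologicalSpace X] : Prop :=
  ∃ x : X, pointLocalDensity x = localDensity X

/-- The dominating number: the cofinality of the functions from `ℕ` to `ℕ`, ordered pointwise. -/
noncomputable def dominatingNumber : Cardinal.{0} :=
  Order.cof (ℕ → ℕ)

/-- The family of countably infinite subsets of the cardinal `κ` (viewed as the set of all
ordinals below it), ordered by inclusion. -/
abbrev CountablyInfiniteSubsets (κ : Cardinal) : Type _ :=
  {s : Set κ.ord.ToType // #s = ℵ₀}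

universe u

/-! Each factor bounds `Order.cof (Compacts X)` from below. Density: compact sets are separable.
`dominatingNumber`: near a point without compact neighborhoods, sequences without convergent
subsequences at every scale let compact sets code functions `ℕ → ℕ`. Countable subsets: a dense
union of separated nets meets each compact set countably, and sequences in it converging to `x` code
all countable subsets of a set of size ld(x). Conversely, by completeness, closed balls around a
sequence of centers and a function `ℕ → ℕ` define a compact set. The centers come from d(X) many
sets of size at most ld(X) whose closures catch all compact sets. -/

theorem exists_dense_card_eq_topDensity (X : Type*) [TopologicalSpace X] :
    ∃ D : Set X, Dense D ∧ #D = topDensity X :=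
  csInf_mem (s := {c | ∃ D : Set X, Dense D ∧ #D = c}) ⟨_, Set.univ, dense_univ, rfl⟩

theorem exists_nhds_topDensity_eq_pointLocalDensity {X : Type*} [TopologicalSpace X] (x : X) :
    ∃ U ∈ 𝓝 x, topDensity U = pointLocalDensity x :=
  csInf_mem (s := {c | ∃ U ∈ 𝓝 x, topDensity U = c}) ⟨_, Set.univ, Filter.univ_mem, rfl⟩

theorem topDensity_le {X : Type*} [TopologicalSpace X] {D : Set X} (hD : Dense D) :
    topDensity X ≤ #D :=
  csInf_le' ⟨D, hD, rfl⟩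

theorem pointLocalDensity_le_localDensity {X : Type*} [TopologicalSpace X] (x : X) :
    pointLocalDensity x ≤ localDensity X :=
  le_ciSup bddAbove_of_small x

/-- A dense set meets every neighborhood of `x` in at least `pointLocalDensity x` points. -/
theorem pointLocalDensity_le_card {X : Type*} [TopologicalSpace X] {x : X} {D U : Set X}
    (hD : Dense D) (hU : IsOpen U) (hx : x ∈ U) :
    pointLocalDensity x ≤ #((↑) ⁻¹' D : Set U) :=
  (csInf_le' ⟨U, hU.mem_nhds hx, rfl⟩ : pointLocalDensity x ≤ topDensity U).trans
    (topDensity_le (hD.preimage hU.isOpenMap_subtype_val))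

theorem localDensity_le_topDensity (X : Type*) [TopologicalSpace X] :
    localDensity X ≤ topDensity X := by
  obtain ⟨D, hD, hDc⟩ := exists_dense_card_eq_topDensity X
  rw [← hDc]
  refine ciSup_le' fun x => (pointLocalDensity_le_card hD isOpen_univ (Set.mem_univ x)).trans ?_
  exact mk_preimage_of_injective _ _ Subtype.val_injective

theorem exists_not_isCompact_nhds {X : Type*} [TopologicalSpace X] [R1Space X]
    (hX : ¬ LocallyCompactSpace X) : ∃ x : X, ∀ U ∈ 𝓝 x, ¬ IsCompact U := by
  by_contra! h
  have : WeaklyLocallyCompactSpace X := ⟨fun x => (h x).imp fun _ hU => ⟨hU.2, hU.1⟩⟩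
  exact hX inferInstance

theorem aleph0_le_localDensity {X : Type*} [TopologicalSpace X] [T2Space X]
    (hX : ¬ LocallyCompactSpace X) : ℵ₀ ≤ localDensity X := by
  obtain ⟨x, hx⟩ := exists_not_isCompact_nhds hX
  obtain ⟨U, hU, hUc⟩ := exists_nhds_topDensity_eq_pointLocalDensity x
  refine le_trans ?_ (pointLocalDensity_le_localDensity x)
  rw [← hUc]
  obtain ⟨D, hD, hDc⟩ := exists_dense_card_eq_topDensity U
  rw [← hDc]
  by_contra! hfin
  have hDf : D.Finite := lt_aleph0_iff_set_finite.1 hfin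
  have huniv : D = Set.univ := by rw [← hDf.isClosed.closure_eq, hD.closure_eq]
  rw [huniv] at hDf
  have : Finite U := Set.finite_univ_iff.1 hDf
  exact hx U hU (Set.toFinite U).isCompact

/-! ### Lower bounds for the cofinality of the compact sets -/

/-- A maximal `ε`-separated set. -/
theorem exists_separated_net (X : Type*) [MetricSpace X] {ε : ℝ} (hε : 0 < ε) :
    ∃ E : Set X, (E.Pairwise fun a b => ε ≤ dist a b) ∧ ∀ x, ∃ e ∈ E, dist x e < ε := by
  obtain ⟨E, hE⟩ := zorn_subset {E : Set X | E.Pairwise fun a b => ε ≤ dist a b}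
    fun c hc hchain => ⟨⋃₀ c, (Set.pairwise_sUnion hchain.directedOn).2 fun s hs => hc hs,
      fun s hs => Set.subset_sUnion_of_mem hs⟩
  refine ⟨E, hE.prop, fun x => ?_⟩
  by_contra! h
  have hxE : x ∈ E := by
    refine hE.le_of_ge (y := insert x E) ?_ (Set.subset_insert x E) (Set.mem_insert x E)
    exact hE.prop.insert fun b hb _ => ⟨h b hb, by rw [dist_comm]; exact h b hb⟩
  have := h x hxE
  rw [dist_self] at this
  linarith

theorem IsCompact.finite_inter_of_pairwise_le_dist {X : Type*} [MetricSpace X] {K E : Set X}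
    {ε : ℝ} (hK : IsCompact K) (hε : 0 < ε) (hE : E.Pairwise fun a b => ε ≤ dist a b) :
    (K ∩ E).Finite := by
  obtain ⟨t, ht, hKt⟩ := Metric.totallyBounded_iff.1 hK.totallyBounded (ε / 2) (by positivity)
  refine (ht.biUnion (t := fun y => Metric.ball y (ε / 2) ∩ E)
    fun y _ => Set.Subsingleton.finite ?_).subset ?_
  · intro a ha b hb
    by_contra hab
    have h1 := hE ha.2 hb.2 hab
    have h2 := dist_triangle_right a b y
    have h3 := Metric.mem_ball.1 ha.1
    have h4 := Metric.mem_ball.1 hb.1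
    linarith
  · intro a ha
    obtain ⟨y, hy, hay⟩ := Set.mem_iUnion₂.1 (hKt ha.1)
    exact Set.mem_iUnion₂.2 ⟨y, hy, hay, ha.2⟩

/-- A metric space has a dense set that meets every compact set in a countable set. -/
theorem exists_dense_countable_inter_compact (X : Type*) [MetricSpace X] :
    ∃ D : Set X, Dense D ∧ ∀ K, IsCompact K → (K ∩ D).Countable := by
  choose E hE hnet using fun n : ℕ => exists_separated_net X (Nat.one_div_pos_of_nat (n := n))
  refine ⟨⋃ n, E n, fun x => Metric.mem_closure_iff.2 fun ε hε => ?_, fun K hK => ?_⟩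
  · obtain ⟨n, hn⟩ := exists_nat_one_div_lt hε
    obtain ⟨e, he, hxe⟩ := hnet n x
    exact ⟨e, Set.mem_iUnion.2 ⟨n, he⟩, hxe.trans hn⟩
  · rw [Set.inter_iUnion]
    exact Set.countable_iUnion fun n =>
      (hK.finite_inter_of_pairwise_le_dist Nat.one_div_pos_of_nat (hE n)).countable

/-- Countable subsets of a set of size at most `pointLocalDensity x` are dominated by a family of
at most `cof (Compacts X)` countable sets. -/
theorem exists_cofinal_countable_family {X : Type u} [MetricSpace X] (x : X) {S : Type u}
    (hS : #S ≤ pointLocalDensity x) :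
    ∃ F : Set (Set S), #F ≤ Order.cof (Compacts X) ∧ (∀ s ∈ F, s.Countable) ∧
      ∀ A : Set S, A.Countable → ∃ s ∈ F, A ⊆ s := by
  obtain ⟨D, hD, hDK⟩ := exists_dense_countable_inter_compact X
  -- `S` is copied into every ball around `x`. Placing the `n`-th element of a countable set in the
  -- `n`-th copy gives a sequence converging to `x`.
  have hj : ∀ n : ℕ, ∃ j : S → X, Function.Injective j ∧
      ∀ a, j a ∈ D ∧ dist (j a) x < 1 / ((n : ℝ) + 1) := fun n => by
    obtain ⟨f⟩ := hS.trans (pointLocalDensity_le_card hD (Metric.isOpen_ball (x := x)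
      (ε := 1 / ((n : ℝ) + 1))) (Metric.mem_ball_self Nat.one_div_pos_of_nat))
    exact ⟨fun a => (f a).1.1, fun a b h => f.injective (Subtype.ext (Subtype.ext h)),
      fun a => ⟨(f a).2, (f a).1.2⟩⟩
  choose j hinj hj using hj
  obtain ⟨C, hC, hCc⟩ := Order.exists_cof_eq (Compacts X)
  let g : Compacts X → Set S := fun K => ⋃ n, j n ⁻¹' (K ∩ D)
  refine ⟨g '' C, mk_image_le.trans hCc.le, ?_, fun A hA => ?_⟩
  · rintro _ ⟨K, -, rfl⟩
    exact Set.countable_iUnion fun n => (hDK K K.isCompact).preimage_of_injOn (hinj n).injOn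
  · rcases A.eq_empty_or_nonempty with rfl | hne
    · obtain ⟨K, hK, -⟩ := hC ⊥
      exact ⟨g K, ⟨K, hK, rfl⟩, Set.empty_subset _⟩
    · obtain ⟨a, rfl⟩ := hA.exists_eq_range hne
      have hlim : Filter.Tendsto (fun n => j n (a n)) Filter.atTop (𝓝 x) :=
        tendsto_iff_dist_tendsto_zero.2 (squeeze_zero (fun _ => dist_nonneg)
          (fun n => (hj n (a n)).2.le) tendsto_one_div_add_atTop_nhds_zero_nat)
      obtain ⟨K, hK, hle⟩ := hC ⟨_, hlim.isCompact_insert_range⟩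
      refine ⟨g K, ⟨K, hK, rfl⟩, ?_⟩
      rintro _ ⟨n, rfl⟩
      exact Set.mem_iUnion.2 ⟨n, hle (Set.mem_insert_of_mem _ ⟨n, rfl⟩), (hj n (a n)).1⟩

theorem cof_countablyInfiniteSubsets_le {κ : Cardinal.{u}} (hκ : ℵ₀ ≤ κ)
    {F : Set (Set κ.ord.ToType)} (hF : ∀ s ∈ F, s.Countable)
    (hcof : ∀ A : Set κ.ord.ToType, A.Countable → ∃ s ∈ F, A ⊆ s) :
    Order.cof (CountablyInfiniteSubsets κ) ≤ #F := by
  -- Adjoining a fixed countably infinite `N` makes every countable set countably infinite.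
  obtain ⟨N, hN⟩ := le_mk_iff_exists_set.1 (hκ.trans_eq (mk_ord_toType κ).symm)
  let g : F → CountablyInfiniteSubsets κ := fun s => ⟨s.1 ∪ N, le_antisymm
    (Set.Countable.le_aleph0 ((hF s.1 s.2).union (le_aleph0_iff_set_countable.1 hN.le)))
    (hN.ge.trans (mk_le_mk_of_subset Set.subset_union_right))⟩
  refine (Order.cof_le (s := Set.range g) fun A => ?_).trans mk_range_le
  obtain ⟨s, hs, hAs⟩ := hcof A.1 (le_aleph0_iff_set_countable.1 A.2.le)
  exact ⟨g ⟨s, hs⟩, ⟨_, rfl⟩, show A.1 ⊆ s ∪ N from hAs.trans Set.subset_union_left⟩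

theorem lift_dominatingNumber_le_cof_compacts {X : Type u} [MetricSpace X]
    (hX : ¬ LocallyCompactSpace X) :
    lift.{u} dominatingNumber ≤ Order.cof (Compacts X) := by
  obtain ⟨x, hx⟩ := exists_not_isCompact_nhds hX
  have hu : ∀ n : ℕ, ∃ u : ℕ → X, (∀ m, dist (u m) x ≤ 1 / ((n : ℝ) + 1)) ∧
      ∀ K, IsCompact K → (u ⁻¹' K).Finite := fun n => by
    have h := hx _ (Metric.closedBall_mem_nhds x (Nat.one_div_pos_of_nat (α := ℝ) (n := n)))
    rw [isCompact_iff_isSeqCompact] at h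
    simp only [IsSeqCompact, not_forall] at h
    obtain ⟨u, hu, hnot⟩ := h
    refine ⟨u, hu, fun K hK => ?_⟩
    by_contra hinf
    obtain ⟨φ, hφ, hφK⟩ := Filter.extraction_of_frequently_atTop
      (Nat.frequently_atTop_iff_infinite.2 hinf)
    obtain ⟨a, -, ψ, hψ, hlim⟩ := hK.isSeqCompact hφK
    exact hnot ⟨a, Metric.isClosed_closedBall.mem_of_tendsto hlim
      (Filter.Eventually.of_forall fun _ => hu _), φ ∘ ψ, hφ.comp hψ, hlim⟩
  choose u hux huK using hu
  obtain ⟨C, hC, hCc⟩ := Order.exists_cof_eq (Compacts X)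
  -- The largest index of a term of `u n` in `K`. To exceed `f`, take the points `u n m` with `m ≤ f
  -- n`: finitely many per scale, so they converge to `x`.
  let g : Compacts X → ℕ → ℕ := fun K n => (huK n K K.isCompact).toFinset.sup id
  rw [← hCc, dominatingNumber]
  have hcof : IsCofinal (g '' C) := fun f => by
    have hlim : Filter.Tendsto (fun p : Σ n, Fin (f n + 1) => u p.1 p.2) Filter.cofinite (𝓝 x) := by
      refine Metric.tendsto_nhds.2 fun ε hε => ?_
      obtain ⟨N, hN⟩ := exists_nat_one_div_lt hε
      rw [Filter.eventually_cofinite]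
      refine ((Set.finite_Iio N).biUnion (t := fun n => Set.range (Sigma.mk n))
        fun n _ => Set.finite_range _).subset fun p hp => ?_
      refine Set.mem_iUnion₂.2 ⟨p.1, ?_, p.2, rfl⟩
      by_contra hNp
      refine hp ((hux _ _).trans_lt (lt_of_le_of_lt ?_ hN))
      exact Nat.one_div_le_one_div (not_lt.1 hNp)
    obtain ⟨K, hK, hle⟩ := hC ⟨_, hlim.isCompact_insert_range_of_cofinite⟩
    refine ⟨g K, ⟨K, hK, rfl⟩, fun n => ?_⟩
    refine Finset.le_sup (f := id) ((huK n K K.isCompact).mem_toFinset.2 (hle ?_))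
    exact Set.mem_insert_of_mem _ ⟨⟨n, ⟨f n, Nat.lt_succ_self _⟩⟩, rfl⟩
  calc lift.{u} (Order.cof (ℕ → ℕ)) ≤ lift.{u} #(g '' C) := lift_le.2 (Order.cof_le hcof)
    _ ≤ lift.{0} #C := mk_image_le_lift
    _ = #C := lift_id' _

theorem aleph0_le_dominatingNumber : ℵ₀ ≤ dominatingNumber := by
  rw [dominatingNumber, Order.le_cof_iff]
  intro s hs
  by_contra! hfin
  have hsf : s.Finite := lt_aleph0_iff_set_finite.1 hfin
  obtain ⟨f, hf⟩ := hsf.bddAbove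
  obtain ⟨h, hhs, hh⟩ := hs (f + 1)
  have := hh 0
  have := hf hhs 0
  simp only [Pi.add_apply, Pi.one_apply] at *
  omega

theorem topDensity_le_cof_compacts {X : Type u} [MetricSpace X]
    (h : ℵ₀ ≤ Order.cof (Compacts X)) : topDensity X ≤ Order.cof (Compacts X) := by
  obtain ⟨C, hC, hCc⟩ := Order.exists_cof_eq (Compacts X)
  choose t ht htK using fun K : Compacts X => K.isCompact.isSeparable
  have hD : Dense (⋃ K : C, t K) := fun x => by
    obtain ⟨K, hK, hle⟩ := hC ⟨{x}, isCompact_singleton⟩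
    exact closure_mono (Set.subset_iUnion (fun K : C => t K) ⟨K, hK⟩)
      (htK K (hle (Set.mem_singleton x)))
  refine (topDensity_le hD).trans ((mk_iUnion_le _).trans ?_)
  rw [hCc]
  exact mul_le_of_le h le_rfl ((ciSup_le' fun K : C => (ht K).le_aleph0.trans h))

theorem cof_countablyInfiniteSubsets_localDensity_le {X : Type u} [MetricSpace X]
    (hX : ¬ LocallyCompactSpace X)
    (hld : LocalDensityRealized X ∨ ℵ₀ < (localDensity X).ord.cof) :
    Order.cof (CountablyInfiniteSubsets (localDensity X)) ≤ Order.cof (Compacts X) := by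
  have hκ := aleph0_le_localDensity hX
  have hinf : ℵ₀ ≤ Order.cof (Compacts X) :=
    (aleph0_le_lift.2 aleph0_le_dominatingNumber).trans (lift_dominatingNumber_le_cof_compacts hX)
  rcases hld with ⟨x, hx⟩ | hcof
  · obtain ⟨F, hFc, hF, hFA⟩ := exists_cofinal_countable_family x
      ((mk_ord_toType (localDensity X)).trans hx.symm).le
    exact (cof_countablyInfiniteSubsets_le hκ hF hFA).trans hFc
  · have hex : ∀ a : (localDensity X).ord.ToType, ∃ F : Set (Set (Set.Iio a)),
        #F ≤ Order.cof (Compacts X) ∧ (∀ s ∈ F, s.Countable) ∧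
          ∀ A : Set (Set.Iio a), A.Countable → ∃ s ∈ F, A ⊆ s := fun a => by
      -- Proper initial segments are smaller than the supremum, so some point serves each of them.
      have ha : #(Set.Iio a) < ⨆ x : X, pointLocalDensity x := by
        simpa using! mk_Iio_lt a (by simp)
      obtain ⟨x, hx⟩ := exists_lt_of_lt_ciSup' ha
      exact exists_cofinal_countable_family x hx.le
    choose F hFc hF hFA using hex
    refine (cof_countablyInfiniteSubsets_le hκ
      (F := ⋃ a, (Set.image Subtype.val) '' F a) ?_ fun A hA => ?_).trans ?_
    · intro s hs
      obtain ⟨a, s, hsa, rfl⟩ := Set.mem_iUnion.1 hs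
      exact (hF a s hsa).image _
    -- An unbounded countable `A` would contradict uncountable cofinality.
    · obtain ⟨a, ha⟩ : ∃ a, A ⊆ Set.Iio a := by
        by_contra! hA'
        refine (hcof.trans_le ?_).not_ge hA.le_aleph0
        rw [← Ordinal.cof_toType]
        refine Order.cof_le fun a => ?_
        obtain ⟨b, hb, hab⟩ := Set.not_subset.1 (hA' a)
        exact ⟨b, hb, not_lt.1 hab⟩
      obtain ⟨s, hs, hAs⟩ := hFA a _ (hA.preimage Subtype.val_injective)
      refine ⟨_, Set.mem_iUnion.2 ⟨a, s, hs, rfl⟩, fun b hb => ⟨⟨b, ha hb⟩, hAs hb, rfl⟩⟩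
    · refine (mk_iUnion_le _).trans (mul_le_of_le hinf ?_ ?_)
      · rw [mk_ord_toType]
        exact (localDensity_le_topDensity X).trans (topDensity_le_cof_compacts hinf)
      · exact ciSup_le' fun a => mk_image_le.trans (hFc a)

/-! ### Upper bound -/

theorem isCompact_iInter_biUnion_closedBall {X : Type*} [MetricSpace X] [CompleteSpace X]
    (a : ℕ → X) (f : ℕ → ℕ) :
    IsCompact (⋂ n : ℕ, ⋃ j ∈ Set.Iic (f n), Metric.closedBall (a j) (1 / ((n : ℝ) + 1))) := by
  refine isCompact_iff_totallyBounded_isComplete.2 ⟨?_, IsClosed.isComplete ?_⟩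
  · refine Metric.totallyBounded_iff.2 fun ε hε => ?_
    obtain ⟨n, hn⟩ := exists_nat_one_div_lt hε
    refine ⟨a '' Set.Iic (f n), (Set.finite_Iic _).image a, fun y hy => ?_⟩
    obtain ⟨j, hj, hyj⟩ := Set.mem_iUnion₂.1 (Set.mem_iInter.1 hy n)
    exact Set.mem_iUnion₂.2 ⟨a j, ⟨j, hj, rfl⟩, Metric.closedBall_subset_ball hn hyj⟩
  · exact isClosed_iInter fun n =>
      (Set.finite_Iic _).isClosed_biUnion fun j _ => Metric.isClosed_closedBall

/-- A compact set in the closure of the range of `e` is described by countably many values of `e`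
and a function that bounds the size of finite covers by small balls around these values. -/
theorem IsCompact.exists_countable_subset_iInter_closedBall {X ι : Type*} [MetricSpace X]
    {K : Set X} (hK : IsCompact K) {e : ι → X} (hKe : K ⊆ closure (Set.range e)) :
    ∃ T : Set ι, T.Countable ∧ ∀ s : ℕ → ι, T ⊆ Set.range s → ∃ f : ℕ → ℕ, ∀ f', f ≤ f' →
      K ⊆ ⋂ n : ℕ, ⋃ j ∈ Set.Iic (f' n), Metric.closedBall (e (s j)) (1 / ((n : ℝ) + 1)) := by
  have hcov : ∀ n : ℕ, ∃ t : Finset ι, K ⊆ ⋃ i ∈ t, Metric.ball (e i) (1 / ((n : ℝ) + 1)) :=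
    fun n => hK.elim_finite_subcover _ (fun _ => Metric.isOpen_ball) fun y hy => by
      obtain ⟨_, ⟨i, rfl⟩, hi⟩ :=
        Metric.mem_closure_iff.1 (hKe hy) _ (Nat.one_div_pos_of_nat (n := n))
      exact Set.mem_iUnion.2 ⟨i, hi⟩
  choose t ht using hcov
  refine ⟨⋃ n, (t n : Set ι), Set.countable_iUnion fun n => (t n).countable_toSet,
    fun s hs => ?_⟩
  have hk : ∀ n (i : t n), ∃ k, s k = i := fun n i => hs (Set.mem_iUnion.2 ⟨n, i.2⟩)
  choose k hk using hk
  refine ⟨fun n => Finset.univ.sup (k n), fun f' hf' y hy => Set.mem_iInter.2 fun n => ?_⟩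
  obtain ⟨i, hi, hyi⟩ := Set.mem_iUnion₂.1 (ht n hy)
  have hle : k n ⟨i, hi⟩ ≤ f' n := (Finset.le_sup (Finset.mem_univ _)).trans (hf' n)
  refine Set.mem_iUnion₂.2 ⟨k n ⟨i, hi⟩, hle, ?_⟩
  rw [hk]
  exact Metric.ball_subset_closedBall hyi

/-- There are `topDensity X` many maps from `localDensity X` to `X` such that every compact set is
in the closure of the range of one of them. -/
theorem exists_family_compact_subset_closure_range {X : Type u} [MetricSpace X]
    (hκ : ℵ₀ ≤ localDensity X) :
    ∃ (I : Type u) (e : I → (localDensity X).ord.ToType → X), #I = topDensity X ∧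
      ∀ K, IsCompact K → ∃ i, K ⊆ closure (Set.range (e i)) := by
  obtain ⟨D, hD, hDc⟩ := exists_dense_card_eq_topDensity X
  have hDinf : ℵ₀ ≤ #D := by
    rw [hDc]
    exact hκ.trans (localDensity_le_topDensity X)
  have : Infinite D := infinite_iff.2 hDinf
  obtain ⟨x₀⟩ : Nonempty X := ⟨(Classical.arbitrary D : X)⟩
  let b : D × ℕ → Set X := fun p => Metric.ball p.1 (1 / ((p.2 : ℝ) + 1))
  -- One small set is fixed for each ball that has one dense in it; other balls get `∅`. Finite
  -- unions of the fixed sets suffice by compactness.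
  have hB : ∀ p, ∃ B : Set X, #B ≤ localDensity X ∧
      ((∃ B' : Set X, #B' ≤ localDensity X ∧ b p ⊆ closure B') → b p ⊆ closure B) := fun p => by
    by_cases h : ∃ B' : Set X, #B' ≤ localDensity X ∧ b p ⊆ closure B'
    · obtain ⟨B, hB⟩ := h
      exact ⟨B, hB.1, fun _ => hB.2⟩
    · exact ⟨∅, by simp, fun h' => (h h').elim⟩
  choose B hBc hB using hB
  have he : ∀ t : Finset (D × ℕ), ∃ e : (localDensity X).ord.ToType → X,
      ∀ p ∈ t, B p ⊆ Set.range e := fun t => by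
    have hle : #(⋃ p ∈ (t : Set (D × ℕ)), B p) ≤ #(localDensity X).ord.ToType := by
      rw [mk_ord_toType]
      refine (mk_biUnion_le _ _).trans (mul_le_of_le hκ ?_ (ciSup_le' fun p => hBc p))
      exact t.countable_toSet.le_aleph0.trans hκ
    obtain ⟨f⟩ := hle
    refine ⟨Function.extend f Subtype.val fun _ => x₀, fun p hp y hy => ?_⟩
    exact ⟨f ⟨y, Set.mem_iUnion₂.2 ⟨p, hp, hy⟩⟩, f.injective.extend_apply _ _ _⟩
  choose e he using he
  refine ⟨Finset (D × ℕ), e, ?_, fun K hK => ?_⟩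
  · rw [mk_finset_of_infinite, mk_prod, lift_uzero, mk_nat, lift_aleph0, mul_aleph0_eq hDinf, hDc]
  · obtain ⟨t, htg, htf, hKt⟩ := hK.elim_finite_subcover_image
      (b := {p | ∃ B' : Set X, #B' ≤ localDensity X ∧ b p ⊆ closure B'}) (c := b)
      (fun p _ => Metric.isOpen_ball) fun y _ => by
        obtain ⟨U, hU, hUc⟩ := exists_nhds_topDensity_eq_pointLocalDensity y
        obtain ⟨E, hE, hEc⟩ := exists_dense_card_eq_topDensity U
        obtain ⟨r, hr, hrU⟩ := Metric.mem_nhds_iff.1 hU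
        obtain ⟨n, hn⟩ := exists_nat_one_div_lt (half_pos hr)
        obtain ⟨d, hd, hyd⟩ := hD.exists_dist_lt y (Nat.one_div_pos_of_nat (n := n))
        refine Set.mem_iUnion₂.2 ⟨(⟨d, hd⟩, n), ⟨Subtype.val '' E, ?_, fun z hz => ?_⟩, hyd⟩
        · exact (mk_image_le.trans (hEc.trans hUc).le).trans (pointLocalDensity_le_localDensity y)
        · have hzU : z ∈ U := hrU <| Metric.mem_ball.2 <| by
            have h1 := dist_triangle_right z y d
            have h2 : dist z d < 1 / ((n : ℝ) + 1) := hz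
            linarith
          exact image_closure_subset_closure_image continuous_subtype_val
            ⟨⟨z, hzU⟩, hE _, rfl⟩
    refine ⟨htf.toFinset, fun y hy => ?_⟩
    obtain ⟨p, hp, hyp⟩ := Set.mem_iUnion₂.1 (hKt hy)
    exact closure_mono (he _ p (htf.mem_toFinset.2 hp)) (hB p (htg hp) hyp)

theorem cof_compacts_le {X : Type u} [MetricSpace X] [CompleteSpace X]
    (hκ : ℵ₀ ≤ localDensity X) :
    Order.cof (Compacts X) ≤ topDensity X * lift.{u} dominatingNumber
      * Order.cof (CountablyInfiniteSubsets (localDensity X)) := by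
  obtain ⟨I, e, hI, heK⟩ := exists_family_compact_subset_closure_range hκ
  obtain ⟨N, hN⟩ := le_mk_iff_exists_set.1 (hκ.trans_eq (mk_ord_toType (localDensity X)).symm)
  obtain ⟨C, hC, hCc⟩ := Order.exists_cof_eq (CountablyInfiniteSubsets (localDensity X))
  obtain ⟨F, hF, hFc⟩ := Order.exists_cof_eq (ℕ → ℕ)
  have hs : ∀ A : CountablyInfiniteSubsets (localDensity X),
      ∃ s : ℕ → (localDensity X).ord.ToType, A.1 = Set.range s := fun A =>
    (le_aleph0_iff_set_countable.1 A.2.le).exists_eq_range <| by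
      rw [← Set.nonempty_coe_sort, ← mk_ne_zero_iff, A.2]
      exact aleph0_ne_zero
  choose s hs using hs
  let G : I × ULift.{u} F × C → Compacts X := fun p =>
    ⟨_, isCompact_iInter_biUnion_closedBall (e p.1 ∘ s p.2.2) p.2.1.down⟩
  have hG : IsCofinal (Set.range G) := fun K => by
    obtain ⟨i, hi⟩ := heK K K.isCompact
    obtain ⟨T, hT, hTs⟩ := K.isCompact.exists_countable_subset_iInter_closedBall hi
    obtain ⟨A, hAC, hA⟩ := hC ⟨T ∪ N, le_antisymm
      (Set.Countable.le_aleph0 (hT.union (le_aleph0_iff_set_countable.1 hN.le)))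
      (hN.ge.trans (mk_le_mk_of_subset Set.subset_union_right))⟩
    obtain ⟨f, hf⟩ := hTs (s A) (hs A ▸ Set.subset_union_left.trans hA)
    obtain ⟨f', hfF, hff'⟩ := hF f
    exact ⟨G (i, ⟨⟨f', hfF⟩⟩, ⟨A, hAC⟩), ⟨_, rfl⟩, hf f' hff'⟩
  refine (Order.cof_le hG).trans (mk_range_le.trans_eq ?_)
  rw [dominatingNumber, ← hFc, ← hCc, ← hI]
  simp [mul_assoc]

/-- A cofinal family covers `κ` by countable sets. This absorbs the factor d(X) when d(X) = ld(X).
-/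
theorem le_aleph0_mul_cof_countablyInfiniteSubsets {κ : Cardinal.{u}} (hκ : ℵ₀ ≤ κ) :
    κ ≤ ℵ₀ * Order.cof (CountablyInfiniteSubsets κ) := by
  obtain ⟨N, hN⟩ := le_mk_iff_exists_set.1 (hκ.trans_eq (mk_ord_toType κ).symm)
  obtain ⟨C, hC, hCc⟩ := Order.exists_cof_eq (CountablyInfiniteSubsets κ)
  have huniv : (⋃ A : C, (A.1.1 : Set κ.ord.ToType)) = Set.univ := by
    refine Set.eq_univ_of_forall fun a => ?_
    obtain ⟨A, hA, hle⟩ := hC ⟨insert a N, le_antisymm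
      (Set.Countable.le_aleph0 ((le_aleph0_iff_set_countable.1 hN.le).insert a))
      (hN.ge.trans (mk_le_mk_of_subset (Set.subset_insert a N)))⟩
    exact Set.mem_iUnion.2 ⟨⟨A, hA⟩, hle (Set.mem_insert a N)⟩
  calc κ = #(⋃ A : C, (A.1.1 : Set κ.ord.ToType)) := by rw [huniv, mk_univ, mk_ord_toType]
    _ ≤ #C * ⨆ A : C, #A.1.1 := mk_iUnion_le _
    _ ≤ #C * ℵ₀ := mul_le_mul_right (ciSup_le' fun A => A.1.2.le) _
    _ = ℵ₀ * Order.cof (CountablyInfiniteSubsets κ) := by rw [hCc, mul_comm]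

theorem mainTheorem12 {X : Type*} [MetricSpace X] [CompleteSpace X]
    (hX : ¬ LocallyCompactSpace X)
    (hld : LocalDensityRealized X ∨ ℵ₀ < (localDensity X).ord.cof) :
    Order.cof (Compacts X) =
        topDensity X * lift dominatingNumber
          * Order.cof (CountablyInfiniteSubsets (localDensity X)) ∧
      (topDensity X = localDensity X →
        Order.cof (Compacts X) =
          lift dominatingNumber * Order.cof (CountablyInfiniteSubsets (topDensity X))) := by
  have hκ := aleph0_le_localDensity hX
  have h𝔡 := lift_dominatingNumber_le_cof_compacts hX
  have hinf : ℵ₀ ≤ Order.cof (Compacts X) :=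
    (aleph0_le_lift.2 aleph0_le_dominatingNumber).trans h𝔡
  have hcof := cof_countablyInfiniteSubsets_localDensity_le hX hld
  have hle := cof_compacts_le hκ
  refine ⟨le_antisymm hle (mul_le_of_le hinf
    (mul_le_of_le hinf (topDensity_le_cof_compacts hinf) h𝔡) hcof), fun h => ?_⟩
  rw [h] at hle ⊢
  refine le_antisymm (hle.trans ?_) (mul_le_of_le hinf h𝔡 hcof)
  set c := Order.cof (CountablyInfiniteSubsets (localDensity X))
  set δ := lift dominatingNumber
  have hδ : ℵ₀ ≤ δ := aleph0_le_lift.2 aleph0_le_dominatingNumber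
  have hc : c ≠ 0 := fun h0 => by
    have := hκ.trans (le_aleph0_mul_cof_countablyInfiniteSubsets hκ)
    simp only [show Order.cof (CountablyInfiniteSubsets (localDensity X)) = 0 from h0,
      mul_zero, nonpos_iff_eq_zero] at this
    exact aleph0_ne_zero this
  have hδc : ℵ₀ ≤ δ * c := hδ.trans (le_mul_right hc)
  rw [mul_assoc]
  refine mul_le_of_le hδc ?_ le_rfl
  exact (le_aleph0_mul_cof_countablyInfiniteSubsets hκ).trans (mul_le_mul_left hδ _)
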